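/- Let $\mathrm{U}(1)$ act on $\mathbb{C}^2$ by $c\cdot(z,w)=(cz,cw)$, let $J$ be multiplication by $i$, let $\omega=\frac i2(dz\wedge d\bar z+dw\wedge d\bar w)$ be the standard Kähler form, and put $d^c=i(\bar\partial-\partial)$, so that $dd^c=2i\partial\bar\partial$. Let $\phi\colon\mathbb{C}^2\to\mathbb{R}$ be a $\mathrm{U}(1)$-invariant real analytic function such that $dd^c\phi\ge\varepsilon\omega$ for some $\varepsilon>0$, that is, $dd^c\phi(v,Jv)\ge\varepsilon\,\omega(v,Jv)$ at every point and for every tangent vector $v$. Let $\mu\colon\mathbb{C}^2\to\mathbb{R}$ be a moment map of the $\mathrm{U}(1)$-action for the symplectic form $dd^c\phi$: a differentiable function with $d\mu=-\iota_X\,dd^c\phi$, where $X(a)=Ja$ is the vector field generating the action (such a $\mu$ is unique up to an additive constant). Let $b\in\mu(\mathbb{C}^2)$ be a regular value of $\mu$. Then $\mu^{-1}(b)$ does not contain $0$, the vector $(\partial_{\bar z}\phi(a),\partial_{\bar w}\phi(a))$ is nonzero for every $a\in\mu^{-1}(b)$, the map $$\iota\colon\mu^{-1}(b)/\mathrm{U}(1)\to\mathbb{P}^1,\qquad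 [a]\mapsto[z:w]\quad\text{for } a=(z,w),$$ is a homeomorphism, by which we identify $\mu^{-1}(b)/\mathrm{U}(1)$ with $\mathbb{P}^1$, and the map $$f\colon\mu^{-1}(b)/\mathrm{U}(1)\to\mathbb{P}^1,\qquad [a]\mapsto[\partial_{\bar z}\phi(a):\partial_{\bar w}\phi(a)],$$ is well defined and continuous. The map $f\circ\iota^{-1}\colon\mathbb{P}^1\to\mathbb{P}^1$ is real analytic and has topological degree $1$, that is, it induces multiplication by $1$ on $H_2(\mathbb{P}^1;\mathbb{Z})\cong\mathbb{Z}$. -/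

import Mathlib

open scoped LinearAlgebra.Projectivization

noncomputable section

/-- The complex plane `ℂ²` with its Hermitian norm. -/
abbrev C2 : Type := EuclideanSpace ℂ (Fin 2)

/-- The complex projective line `ℙ¹`, as the space of complex lines in `ℂ²`. -/
abbrev P1 : Type := ℙ ℂ C2

/-- `ℙ¹` carries the quotient topology of `ℂ² ∖ {0}`. -/
instance instTopologicalSpaceP1 : TopologicalSpace P1 :=
  inferInstanceAs (TopologicalSpace (Quotient (projectivizationSetoid ℂ C2)))

/-- The complex structure `J`, multiplication by `i`, as a real linear map. -/
def complexJ : C2 →L[ℝ] C2 :=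
  (Complex.I • ContinuousLinearMap.id ℂ C2).restrictScalars ℝ

/-- The standard Kähler form `ω(u, v) = ⟨Ju, v⟩`, that is `dx₁ ∧ dy₁ + dx₂ ∧ dy₂`. -/
def kahlerForm (u v : C2) : ℝ := (inner ℂ (complexJ u) v).re

/-- The one-form `d^cφ = i(∂̄ - ∂)φ = -dφ ∘ J`. -/
def dc (φ : C2 → ℝ) (a : C2) : C2 [⋀^Fin 1]→L[ℝ] ℝ :=
  ContinuousAlternatingMap.ofSubsingleton ℝ C2 ℝ (0 : Fin 1) (-((fderiv ℝ φ a).comp complexJ))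

/-- The two-form `dd^cφ = 2i∂∂̄φ`. -/
def ddc (φ : C2 → ℝ) (a : C2) : C2 [⋀^Fin 2]→L[ℝ] ℝ := extDeriv (dc φ) a

/-- The inequality `dd^cφ ≥ εω` of real `(1,1)`-forms: it is tested on the pairs `(v, Jv)`. -/
def DdcGe (φ : C2 → ℝ) (ε : ℝ) : Prop :=
  ∀ a v : C2, ε * kahlerForm v (complexJ v) ≤ ddc φ a ![v, complexJ v]

/-- `μ` is a moment map, for the symplectic form `dd^cφ`, of the diagonal action of `U(1)` on
`ℂ²`, whose generating vector field is `a ↦ Ja`: `dμ = -ι_{Ja} dd^cφ`. With this sign `μ` is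
bounded below when `φ` is strictly plurisubharmonic. -/
def IsMomentMap (φ μ : C2 → ℝ) : Prop :=
  Differentiable ℝ μ ∧ ∀ a v : C2, fderiv ℝ μ a v = -(ddc φ a ![complexJ a, v])

/-- `b` is a regular value of `μ`. -/
def IsRegularValue (μ : C2 → ℝ) (b : ℝ) : Prop :=
  ∀ a : C2, μ a = b → Function.Surjective (fderiv ℝ μ a)

/-- Two points of the level set `μ⁻¹(b)` are equivalent when they lie in one `U(1)`-orbit. -/
def orbitSetoid (μ : C2 → ℝ) (b : ℝ) : Setoid {a : C2 // μ a = b} :=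
  (MulAction.orbitRel Circle C2).comap Subtype.val

/-- The reduced space `μ⁻¹(b)/U(1)`, with the quotient topology. -/
abbrev ReducedSpace (μ : C2 → ℝ) (b : ℝ) : Type := Quotient (orbitSetoid μ b)

/-- The class in `μ⁻¹(b)/U(1)` of a point of the level set. -/
def reducedMk {μ : C2 → ℝ} {b : ℝ} (a : C2) (ha : μ a = b) : ReducedSpace μ b :=
  Quotient.mk (orbitSetoid μ b) ⟨a, ha⟩

/-- The vector `(∂φ/∂z̄₀, ∂φ/∂z̄₁)` at `a`, with `∂/∂z̄ = (∂/∂x + i ∂/∂y)/2`. -/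
def dbar (φ : C2 → ℝ) (a : C2) : C2 :=
  WithLp.toLp 2 fun j : Fin 2 =>
    (1 / 2 : ℂ) * ((fderiv ℝ φ a (EuclideanSpace.single j (1 : ℂ)) : ℂ) +
      Complex.I * (fderiv ℝ φ a (EuclideanSpace.single j Complex.I) : ℂ))

/-- The vectors `(1, t)` (for `i = 0`) and `(t, 1)` (for `i = 1`). -/
def affineVec (i : Fin 2) (t : ℂ) : C2 := if i = 0 then !₂[1, t] else !₂[t, 1]

theorem affineVec_ne_zero (i : Fin 2) (t : ℂ) : affineVec i t ≠ 0 := by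
  intro h
  have h1 := congrArg (fun x : C2 => x i) h
  fin_cases i <;> simp [affineVec] at h1

/-- The affine parametrizations `t ↦ [1 : t]` and `t ↦ [t : 1]` of `ℙ¹`. -/
def affinePoint (i : Fin 2) (t : ℂ) : P1 := Projectivization.mk ℂ (affineVec i t)
  (affineVec_ne_zero i t)

/-- The inverse affine coordinates: `[z : w] ↦ w / z` (for `i = 0`) and `[z : w] ↦ z / w`
(for `i = 1`), on the chart domain where the denominator is nonzero. -/
def affineCoord (i : Fin 2) (p : P1) : ℂ := p.rep (1 - i) / p.rep i

/-- `F : ℙ¹ → ℙ¹` is real analytic: it is continuous, and real analytic when read in the two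
standard affine charts of the source and of the target. -/
def IsRealAnalyticP1 (F : P1 → P1) : Prop :=
  Continuous F ∧ ∀ (i j : Fin 2) (t : ℂ), (F (affinePoint i t)).rep j ≠ 0 →
    AnalyticAt ℝ (fun s : ℂ => affineCoord j (F (affinePoint i s))) t

/-- The singular homology group `H₂(ℙ¹; ℤ)` (it is infinite cyclic). -/
abbrev H2P1 : ModuleCat.{0} ℤ :=
  ((AlgebraicTopology.singularHomologyFunctor (ModuleCat.{0} ℤ) 2).obj (ModuleCat.of ℤ ℤ)).obj
    (TopCat.of P1)

/-- The endomorphism of `H₂(ℙ¹; ℤ)` induced by a continuous self-map of `ℙ¹`. -/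
def mapH2P1 (F : C(P1, P1)) : H2P1 ⟶ H2P1 :=
  ((AlgebraicTopology.singularHomologyFunctor (ModuleCat.{0} ℤ) 2).obj (ModuleCat.of ℤ ℤ)).map
    (TopCat.ofHom F)

/-- `F` has topological degree `d`: it acts on the top homology group `H₂(ℙ¹; ℤ) ≅ ℤ` as
multiplication by `d`. -/
def HasDegree (F : C(P1, P1)) (d : ℤ) : Prop :=
  ∀ x : H2P1, (mapH2P1 F).hom x = d • x

end

open Topology Filter

/-! Invariance of φ forces μ to be, up to a constant, the radial derivative of φ: μ(a) = dφ_a(a) +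
μ(0) (`IsMomentMap.eq_radial`). The bound dd^cφ ≥ εω makes μ increase along every ray, at least
quadratically, so for b > μ(0) the level set meets each ray exactly once, and the implicit function
theorem makes the radius analytic (`IsMomentMap.levelIsRadialGraph`). Hence μ⁻¹(b)/U(1) is ℙ¹, and f
∘ ι⁻¹ has an analytic lift.

For the degree, Re⟨∂̄φ(a), a⟩ = dφ_a(a)/2 = (b - μ(0))/2 > 0 on the level set. So ∂̄φ(a) ≠ 0, and
the segment from ∂̄φ(a) to a misses 0. This equivariant segment descends to a homotopy from f to ι
(`reducedMap_homotopic`), whence f ∘ ι⁻¹ is homotopic to the identity. -/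

theorem AnalyticAt.clm_apply_clm {E F G : Type*} [NormedAddCommGroup E] [NormedSpace ℝ E]
    [NormedAddCommGroup F] [NormedSpace ℝ F] [NormedAddCommGroup G] [NormedSpace ℝ G]
    {f : E → F →L[ℝ] G} {g : E → F} {x : E} (hf : AnalyticAt ℝ f x) (hg : AnalyticAt ℝ g x) :
    AnalyticAt ℝ (fun y => f y (g y)) x :=
  ((ContinuousLinearMap.id ℝ (F →L[ℝ] G)).analyticAt_bilinear (f x, g x)).comp₂ hf hg

theorem complexJ_apply (v : C2) : complexJ v = Complex.I • v := rfl

theorem complexJ_complexJ (v : C2) : complexJ (complexJ v) = -v := by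
  simp [complexJ_apply, smul_smul]

/-- Since d^cφ = -dφ ∘ J with J constant, its exterior derivative only involves the Hessian of φ. -/
theorem ddc_apply {φ : C2 → ℝ} (hφ : AnalyticOnNhd ℝ φ Set.univ) (a u v : C2) :
    ddc φ a ![u, v] =
      fderiv ℝ (fderiv ℝ φ) a v (complexJ u) - fderiv ℝ (fderiv ℝ φ) a u (complexJ v) := by
  have hd : Differentiable ℝ (fderiv ℝ φ) := fun x => (hφ.fderiv x trivial).differentiableAt
  have key : ∀ w x : C2, fderiv ℝ (fun y => dc φ y (fun _ => w)) a x =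
      -(fderiv ℝ (fderiv ℝ φ) a x (complexJ w)) := by
    intro w x
    have h1 : (fun y => dc φ y (fun _ => w)) = fun y => -(fderiv ℝ φ y (complexJ w)) := by
      funext y; simp [dc]
    rw [h1, fderiv_fun_neg, fderiv_clm_apply (hd a) (differentiableAt_const _)]
    simp
  have hdc : DifferentiableAt ℝ (dc φ) a := by
    have : dc φ = fun y => ContinuousAlternatingMap.ofSubsingletonLIE (𝕜 := ℝ) (E := C2) (F := ℝ) (0 : Fin 1)
        (-((fderiv ℝ φ y).comp complexJ)) := rfl
    rw [this]
    have := hd a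
    fun_prop
  rw [ddc, extDeriv_apply hdc, Fin.sum_univ_two]
  have e0 : (Fin.removeNth 0 ![u, v] : Fin 1 → C2) = fun _ => v := by
    ext i; fin_cases i; simp [Fin.removeNth]
  have e1 : (Fin.removeNth 1 ![u, v] : Fin 1 → C2) = fun _ => u := by
    ext i; fin_cases i; simp [Fin.removeNth]
  rw [e0, e1, key, key]
  simp
  ring

/-! ### Consequences of U(1)-invariance -/

section Invariance

variable {φ : C2 → ℝ} (hφ : AnalyticOnNhd ℝ φ Set.univ)
  (hinv : ∀ (c : Circle) (a : C2), φ (c • a) = φ a)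

include hφ hinv

theorem fderiv_circle_smul (c : Circle) (a v : C2) :
    fderiv ℝ φ (c • a) (c • v) = fderiv ℝ φ a v := by
  have hd : Differentiable ℝ φ := fun x => (hφ x trivial).differentiableAt
  let L : C2 →L[ℝ] C2 := ((c : ℂ) • ContinuousLinearMap.id ℂ C2).restrictScalars ℝ
  have h1 : (fun x => φ (L x)) = φ := funext fun x => hinv c x
  have h2 : HasFDerivAt (fun x => φ (L x)) ((fderiv ℝ φ (L a)).comp L) a :=
    (hd (L a)).hasFDerivAt.comp a L.hasFDerivAt
  rw [h1] at h2
  rw [h2.fderiv]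
  rfl

/-- Differentiate the constant function t ↦ φ(e^{it}a) at t = 0. -/
theorem fderiv_apply_complexJ_self (a : C2) : fderiv ℝ φ a (complexJ a) = 0 := by
  have hd : Differentiable ℝ φ := fun x => (hφ x trivial).differentiableAt
  have h1 : HasDerivAt (fun t : ℝ => Complex.exp (t * Complex.I)) Complex.I 0 := by
    have := ((hasDerivAt_id (0 : ℝ)).ofReal_comp.mul_const Complex.I).cexp
    simpa using this
  have h2 : HasDerivAt (fun t : ℝ => Complex.exp (t * Complex.I) • a) (Complex.I • a) 0 :=
    h1.smul_const a
  have h3 := (hd (Complex.exp ((0 : ℝ) * Complex.I) • a)).hasFDerivAt.comp_hasDerivAt (0 : ℝ) h2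
  have h4 : (φ ∘ fun t : ℝ => Complex.exp (t * Complex.I) • a) = fun _ => φ a := by
    funext t
    simpa [Circle.smul_def] using hinv (Circle.exp t) a
  rw [h4] at h3
  have := h3.unique (hasDerivAt_const _ _)
  simpa [complexJ_apply] using this

/-- Differentiate the identity dφ_y(Jy) = 0 at y = a in the direction w. -/
theorem fderiv_fderiv_apply_complexJ_self (a w : C2) :
    fderiv ℝ (fderiv ℝ φ) a w (complexJ a) = -(fderiv ℝ φ a (complexJ w)) := by
  have hd : Differentiable ℝ (fderiv ℝ φ) := fun x => (hφ.fderiv x trivial).differentiableAt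
  have h1 : (fun y => fderiv ℝ φ y (complexJ y)) = fun _ => 0 :=
    funext fun y => fderiv_apply_complexJ_self hφ hinv y
  have h2 := ((hd a).hasFDerivAt.clm_apply complexJ.hasFDerivAt).fderiv
  rw [h1] at h2
  have h3 := congrArg (fun L : C2 →L[ℝ] ℝ => L w) h2
  simp at h3
  linarith

/-- The moment map is the radial derivative of the potential, up to a constant. -/
theorem IsMomentMap.eq_radial {μ : C2 → ℝ} (hμ : IsMomentMap φ μ) (a : C2) :
    μ a = fderiv ℝ φ a a + μ 0 := by
  have hd : Differentiable ℝ (fderiv ℝ φ) := fun x => (hφ.fderiv x trivial).differentiableAt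
  have h1 : ∀ x, HasFDerivAt (fun y => μ y - fderiv ℝ φ y y) (0 : C2 →L[ℝ] ℝ) x := by
    intro x
    have h2 := (hμ.1 x).hasFDerivAt.sub ((hd x).hasFDerivAt.clm_apply (hasFDerivAt_id x))
    refine h2.congr_fderiv ?_
    ext v
    have h3 := hμ.2 x v
    rw [ddc_apply hφ, complexJ_complexJ] at h3
    -- With J² = -1 and a symmetric Hessian, this turns the term D²φ(Jx, Jv) of dμ(v) into dφ(v);
    -- the other term is D²φ(v, x), and their sum is the derivative of y ↦ dφ_y(y).
    have h4 := fderiv_fderiv_apply_complexJ_self hφ hinv x (complexJ v)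
    have hs : fderiv ℝ (fderiv ℝ φ) x (complexJ x) (complexJ v) =
        fderiv ℝ (fderiv ℝ φ) x (complexJ v) (complexJ x) := by
      have : IsSymmSndFDerivAt ℝ φ x := (hφ x trivial).contDiffAt.isSymmSndFDerivAt_of_omega
      exact this.eq _ _
    rw [complexJ_complexJ] at h4
    simp at h3 h4 ⊢
    linarith
  have h5 := is_const_of_fderiv_eq_zero (𝕜 := ℝ) (fun x => (h1 x).differentiableAt)
    (fun x => (h1 x).fderiv) a 0
  simp at h5
  linarith

theorem IsMomentMap.analyticAt {μ : C2 → ℝ} (hμ : IsMomentMap φ μ) (a : C2) :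
    AnalyticAt ℝ μ a := by
  have h : μ = fun a => fderiv ℝ φ a a + μ 0 := funext (hμ.eq_radial hφ hinv)
  have h1 : AnalyticAt ℝ (fderiv ℝ φ) a := hφ.fderiv a trivial
  rw [h]
  exact (h1.clm_apply_clm analyticAt_id).add analyticAt_const

theorem IsMomentMap.smul_circle {μ : C2 → ℝ} (hμ : IsMomentMap φ μ) (c : Circle) (a : C2) :
    μ (c • a) = μ a := by
  rw [hμ.eq_radial hφ hinv, hμ.eq_radial hφ hinv a, fderiv_circle_smul hφ hinv]

end Invariance

/-! ### The vector ∂̄φ as half the real gradient -/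

theorem re_inner_dbar (φ : C2 → ℝ) (a v : C2) :
    (inner ℂ (dbar φ a) v).re = fderiv ℝ φ a v / 2 := by
  have hv : v = (v 0).re • EuclideanSpace.single (0 : Fin 2) (1 : ℂ) +
      (v 0).im • EuclideanSpace.single (0 : Fin 2) Complex.I +
      (v 1).re • EuclideanSpace.single (1 : Fin 2) (1 : ℂ) +
      (v 1).im • EuclideanSpace.single (1 : Fin 2) Complex.I := by
    ext i
    fin_cases i <;> apply Complex.ext <;> simp
  conv_rhs => rw [hv]
  simp [dbar, PiLp.inner_apply, Fin.sum_univ_two]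
  ring

theorem dbar_circle_smul {φ : C2 → ℝ} (hφ : AnalyticOnNhd ℝ φ Set.univ)
    (hinv : ∀ (c : Circle) (a : C2), φ (c • a) = φ a) (c : Circle) (a : C2) :
    dbar φ (c • a) = c • dbar φ a := by
  rw [← sub_eq_zero, ← inner_self_eq_zero (𝕜 := ℂ)]
  -- Real parts of pairings determine a vector, so equivariance reduces to that of dφ.
  have key : ∀ w : C2, (inner ℂ (dbar φ (c • a) - c • dbar φ a) w).re = 0 := by
    intro w
    obtain ⟨v, rfl⟩ : ∃ v : C2, w = c • v := ⟨c⁻¹ • w, by simp⟩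
    have h1 := re_inner_dbar φ (c • a) (c • v)
    have h2 := re_inner_dbar φ a v
    rw [fderiv_circle_smul hφ hinv] at h1
    have h3 : inner ℂ (c • dbar φ a) (c • v) = inner ℂ (dbar φ a) v := by
      simp only [Circle.smul_def, inner_smul_left, inner_smul_right, ← mul_assoc]
      rw [mul_comm, ← Circle.coe_inv_eq_conj]
      simp
    rw [inner_sub_left, h3, Complex.sub_re, h1, h2, sub_self]
  apply Complex.ext
  · exact key _
  · exact inner_self_im (𝕜 := ℂ) (dbar φ (c • a) - c • dbar φ a)

theorem dbar_analyticAt {φ : C2 → ℝ} (hφ : AnalyticOnNhd ℝ φ Set.univ) (a : C2) (j : Fin 2) :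
    AnalyticAt ℝ (fun x => dbar φ x j) a := by
  have h1 : AnalyticAt ℝ (fderiv ℝ φ) a := hφ.fderiv a trivial
  have h2 : ∀ v : C2, AnalyticAt ℝ (fun x => ((fderiv ℝ φ x v : ℝ) : ℂ)) a := fun v =>
    (Complex.ofRealCLM.analyticAt _).comp (h1.clm_apply_clm analyticAt_const)
  exact analyticAt_const.mul ((h2 _).add (analyticAt_const.mul (h2 _)))

theorem dbar_continuous {φ : C2 → ℝ} (hφ : AnalyticOnNhd ℝ φ Set.univ) :
    Continuous (dbar φ) :=
  (PiLp.continuous_toLp 2 _).comp (continuous_pi fun j =>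
    continuous_iff_continuousAt.2 fun a => (dbar_analyticAt hφ a j).continuousAt)

/-! ### Growth of the moment map along rays -/

section Radial

variable {φ μ : C2 → ℝ} {ε b : ℝ}

theorem kahlerForm_complexJ_self (v : C2) : kahlerForm v (complexJ v) = ‖v‖ ^ 2 := by
  have h : ‖complexJ v‖ = ‖v‖ := by simp [complexJ_apply, norm_smul]
  rw [kahlerForm, ← h]
  exact inner_self_eq_norm_sq (𝕜 := ℂ) (complexJ v)

/-- The generating field vanishes at the origin, so a regular level avoids it. -/
theorem IsMomentMap.fderiv_zero (hμ : IsMomentMap φ μ) : fderiv ℝ μ 0 = 0 := by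
  ext v
  rw [hμ.2 0 v, (ddc φ 0).map_coord_zero (0 : Fin 2) (by simp)]
  simp

theorem IsMomentMap.le_fderiv_self (hφ : AnalyticOnNhd ℝ φ Set.univ) (hpsh : DdcGe φ ε)
    (hμ : IsMomentMap φ μ) (a : C2) : ε * ‖a‖ ^ 2 ≤ fderiv ℝ μ a a := by
  have h1 := hpsh a a
  rw [kahlerForm_complexJ_self] at h1
  rw [hμ.2 a a]
  rw [ddc_apply hφ] at h1 ⊢
  linarith

theorem IsMomentMap.hasDerivAt_radial (hμ : IsMomentMap φ μ) (v : C2) (s : ℝ) :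
    HasDerivAt (fun s : ℝ => μ (s • v)) (fderiv ℝ μ (s • v) v) s := by
  have h1 : HasDerivAt (fun s : ℝ => s • v) ((1 : ℝ) • v) s := (hasDerivAt_id s).smul_const v
  rw [one_smul] at h1
  exact (hμ.1 (s • v)).hasFDerivAt.comp_hasDerivAt s h1

theorem IsMomentMap.le_deriv_radial (hφ : AnalyticOnNhd ℝ φ Set.univ) (hpsh : DdcGe φ ε)
    (hμ : IsMomentMap φ μ) (v : C2) {s : ℝ} (hs : 0 < s) :
    ε * s * ‖v‖ ^ 2 ≤ fderiv ℝ μ (s • v) v := by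
  have h1 := hμ.le_fderiv_self hφ hpsh (s • v)
  rw [map_smul, norm_smul, Real.norm_eq_abs, abs_of_pos hs, smul_eq_mul] at h1
  refine le_of_mul_le_mul_left ?_ hs
  linarith

theorem IsMomentMap.strictMonoOn_radial (hφ : AnalyticOnNhd ℝ φ Set.univ) (hε : 0 < ε)
    (hpsh : DdcGe φ ε) (hμ : IsMomentMap φ μ) {v : C2} (hv : v ≠ 0) :
    StrictMonoOn (fun s : ℝ => μ (s • v)) (Set.Ici 0) := by
  refine strictMonoOn_of_deriv_pos (convex_Ici 0)
    (fun s _ => (hμ.hasDerivAt_radial v s).continuousAt.continuousWithinAt) fun s hs => ?_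
  rw [interior_Ici] at hs
  rw [(hμ.hasDerivAt_radial v s).deriv]
  have hs' : 0 < s := hs
  have := norm_pos_iff.2 hv
  exact lt_of_lt_of_le (by positivity) (hμ.le_deriv_radial hφ hpsh v hs')

/-- Integrating the derivative bound gives the growth that makes each ray reach every level above
μ(0). -/
theorem IsMomentMap.quadratic_le_radial (hφ : AnalyticOnNhd ℝ φ Set.univ)
    (hpsh : DdcGe φ ε) (hμ : IsMomentMap φ μ) (v : C2) {s : ℝ} (hs : 0 ≤ s) :
    μ 0 + ε * ‖v‖ ^ 2 / 2 * s ^ 2 ≤ μ (s • v) := by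
  have hd : ∀ s : ℝ, HasDerivAt (fun s : ℝ => μ (s • v) - ε * ‖v‖ ^ 2 / 2 * s ^ 2)
      (fderiv ℝ μ (s • v) v - ε * ‖v‖ ^ 2 / 2 * (2 * s)) s := fun s => by
    exact ((hμ.hasDerivAt_radial v s).fun_sub
      ((hasDerivAt_pow 2 s).const_mul (ε * ‖v‖ ^ 2 / 2))).congr_deriv (by simp)
  have hm : MonotoneOn (fun s : ℝ => μ (s • v) - ε * ‖v‖ ^ 2 / 2 * s ^ 2) (Set.Ici 0) := by
    refine monotoneOn_of_deriv_nonneg (convex_Ici 0)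
      (fun s _ => (hd s).continuousAt.continuousWithinAt)
      (fun s _ => (hd s).differentiableAt.differentiableWithinAt) fun s hs => ?_
    rw [interior_Ici] at hs
    rw [(hd s).deriv]
    have := hμ.le_deriv_radial hφ hpsh v hs
    linarith
  have := hm (Set.self_mem_Ici) hs hs
  simp at this
  linarith

theorem IsMomentMap.exists_radius (hφ : AnalyticOnNhd ℝ φ Set.univ) (hε : 0 < ε)
    (hpsh : DdcGe φ ε) (hμ : IsMomentMap φ μ) (hb : μ 0 < b) {v : C2} (hv : v ≠ 0) :
    ∃ s : ℝ, 0 < s ∧ μ (s • v) = b := by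
  set k := ε * ‖v‖ ^ 2 / 2 with hk
  have hk0 : 0 < k := by
    have := norm_pos_iff.2 hv
    positivity
  -- T solves μ(0) + kT² = b, so μ(Tv) ≥ b.
  set T := Real.sqrt ((b - μ 0) / k) with hT
  have hT2 : k * T ^ 2 = b - μ 0 := by
    rw [hT, Real.sq_sqrt (div_nonneg (by linarith) hk0.le)]
    field_simp
  have h1 := hμ.quadratic_le_radial hφ hpsh v (Real.sqrt_nonneg ((b - μ 0) / k))
  rw [← hk, ← hT, hT2] at h1
  have hc : ContinuousOn (fun s : ℝ => μ (s • v)) (Set.Icc 0 T) := fun s _ =>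
    (hμ.hasDerivAt_radial v s).continuousAt.continuousWithinAt
  obtain ⟨s, hs, hsb⟩ := intermediate_value_Icc (Real.sqrt_nonneg _) hc
    (show b ∈ Set.Icc _ _ from ⟨by simpa using hb.le, by simpa using h1⟩)
  refine ⟨s, lt_of_le_of_ne hs.1 ?_, hsb⟩
  rintro rfl
  simp at hsb
  exact hb.ne hsb

/-- The positive factor scaling `v` into the level set `μ⁻¹(b)`. -/
noncomputable def levelRadius (μ : C2 → ℝ) (b : ℝ) (v : C2) : ℝ :=
  Classical.epsilon fun s : ℝ => 0 < s ∧ μ (s • v) = b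

/-- The level set `μ⁻¹(b)` meets every ray from the origin exactly once, at a positive distance
which depends analytically on the ray, and it is invariant under `U(1)`. -/
structure LevelIsRadialGraph (μ : C2 → ℝ) (b : ℝ) : Prop where
  ne_zero : ∀ a, μ a = b → a ≠ 0
  radius_pos : ∀ v, v ≠ 0 → 0 < levelRadius μ b v
  radius_mem : ∀ v, v ≠ 0 → μ (levelRadius μ b v • v) = b
  eq_radius : ∀ v, v ≠ 0 → ∀ s : ℝ, 0 < s → μ (s • v) = b → s = levelRadius μ b v
  smul_circle : ∀ (c : Circle) (a : C2), μ (c • a) = μ a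
  analyticAt_radius : ∀ v, v ≠ 0 → AnalyticAt ℝ (levelRadius μ b) v

theorem IsMomentMap.ne_zero_of_regular (hμ : IsMomentMap φ μ) (hreg : IsRegularValue μ b)
    (a : C2) (ha : μ a = b) : a ≠ 0 := by
  rintro rfl
  obtain ⟨v, hv⟩ := hreg 0 ha 1
  simp [hμ.fderiv_zero] at hv

theorem IsMomentMap.zero_lt_of_regular (hφ : AnalyticOnNhd ℝ φ Set.univ) (hε : 0 < ε)
    (hpsh : DdcGe φ ε) (hμ : IsMomentMap φ μ) (hb : b ∈ Set.range μ)
    (hreg : IsRegularValue μ b) : μ 0 < b := by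
  obtain ⟨a, ha⟩ := hb
  have := hμ.strictMonoOn_radial hφ hε hpsh (hμ.ne_zero_of_regular hreg a ha)
    (Set.self_mem_Ici) (show (1 : ℝ) ∈ Set.Ici 0 by simp) one_pos
  simpa [ha] using this

theorem IsMomentMap.levelIsRadialGraph (hφ : AnalyticOnNhd ℝ φ Set.univ)
    (hinv : ∀ (c : Circle) (a : C2), φ (c • a) = φ a) (hε : 0 < ε)
    (hpsh : DdcGe φ ε) (hμ : IsMomentMap φ μ) (hb : b ∈ Set.range μ)
    (hreg : IsRegularValue μ b) : LevelIsRadialGraph μ b := by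
  have h0 := hμ.zero_lt_of_regular hφ hε hpsh hb hreg
  have hspec : ∀ v, v ≠ 0 → 0 < levelRadius μ b v ∧ μ (levelRadius μ b v • v) = b := fun v hv =>
    Classical.epsilon_spec (hμ.exists_radius hφ hε hpsh h0 hv)
  have huniq : ∀ v, v ≠ 0 → ∀ s : ℝ, 0 < s → μ (s • v) = b → s = levelRadius μ b v :=
    fun v hv s hs hsb => (hμ.strictMonoOn_radial hφ hε hpsh hv).injOn hs.le (hspec v hv).1.le
      (hsb.trans (hspec v hv).2.symm)
  refine ⟨hμ.ne_zero_of_regular hreg, fun v hv => (hspec v hv).1, fun v hv => (hspec v hv).2,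
    huniq, hμ.smul_circle hφ hinv, fun v hv => ?_⟩
  set r := levelRadius μ b v with hr
  let G : C2 × ℝ → ℝ := fun p => μ (p.2 • p.1)
  have hGan : AnalyticAt ℝ G (v, r) :=
    AnalyticAt.comp (g := μ) (f := fun p : C2 × ℝ => p.2 • p.1)
      (hμ.analyticAt hφ hinv _) (analyticAt_snd.smul analyticAt_fst)
  -- Here ⊤ is the analytic smoothness class ω, so the implicit function is analytic too.
  have hG : ContDiffAt ℝ (⊤ : WithTop ℕ∞) G (v, r) := hGan.contDiffAt
  have hd : HasDerivAt (fun s : ℝ => μ (s • v)) (fderiv ℝ G (v, r) (0, 1)) r := by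
    have h1 : HasDerivAt (fun s : ℝ => (v, s)) ((0 : C2), (1 : ℝ)) r :=
      (hasDerivAt_const r v).prodMk (hasDerivAt_id r)
    exact hGan.differentiableAt.hasFDerivAt.comp_hasDerivAt r h1
  have hpos : fderiv ℝ G (v, r) (0, 1) ≠ 0 := by
    rw [hd.unique (hμ.hasDerivAt_radial v r)]
    have h1 := hμ.le_deriv_radial hφ hpsh v (hspec v hv).1
    have h2 := norm_pos_iff.2 hv
    have h3 := (hspec v hv).1
    exact (lt_of_lt_of_le (by positivity) h1).ne'
  have hinvt : (fderiv ℝ G (v, r) ∘L .inr ℝ C2 ℝ).IsInvertible := by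
    refine ⟨ContinuousLinearEquiv.unitsEquivAut ℝ (Units.mk0 _ hpos), ?_⟩
    ext
    simp
  have han := (hG.contDiffAt_implicitFunction (by simp) hinvt).analyticAt
  refine han.congr ?_
  have h1 := hG.eventually_apply_implicitFunction (by simp) hinvt
  -- Positivity lets uniqueness of the radius identify the implicit function with `levelRadius` near
  -- v.
  have h2 : ∀ᶠ x in 𝓝 v, 0 < hG.implicitFunction (by simp) hinvt x := by
    refine han.continuousAt.eventually (lt_mem_nhds ?_)
    rw [hG.implicitFunction_apply_self (by simp) hinvt]
    exact (hspec v hv).1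
  filter_upwards [h1, h2, isOpen_ne.mem_nhds hv] with x hx1 hx2 hx3
  exact huniq x hx3 _ hx2 (hx1.trans (hspec v hv).2)

end Radial

/-! ### Topology and affine charts of ℙ¹ -/

theorem isQuotientMap_mk' :
    IsQuotientMap (Projectivization.mk' ℂ : {v : C2 // v ≠ 0} → P1) :=
  isQuotientMap_quot_mk

theorem continuous_projectivization_mk {X : Type*} [TopologicalSpace X] {g : X → C2}
    (hg : Continuous g) (h0 : ∀ x, g x ≠ 0) :
    Continuous fun x => (Projectivization.mk ℂ (g x) (h0 x) : P1) :=
  isQuotientMap_mk'.continuous.comp (hg.subtype_mk h0)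

theorem affineVec_analyticAt (i : Fin 2) (t : ℂ) : AnalyticAt ℝ (affineVec i) t := by
  have h : affineVec i = fun s : ℂ => EuclideanSpace.single i (1 : ℂ) +
      s • EuclideanSpace.single (1 - i) (1 : ℂ) := by
    funext s
    ext k
    fin_cases i <;> fin_cases k <;> simp [affineVec]
  rw [h]
  exact analyticAt_const.add (analyticAt_id.smul analyticAt_const)

theorem exists_rep_mk_eq (w : C2) (hw : w ≠ 0) :
    ∃ c : ℂ, c ≠ 0 ∧ ∀ k, (Projectivization.mk ℂ w hw).rep k = c * w k := by
  obtain ⟨c, hc⟩ := Projectivization.exists_smul_eq_mk_rep ℂ w hw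
  exact ⟨c, c.ne_zero, fun k => by rw [← hc]; rfl⟩

theorem affineCoord_mk (j : Fin 2) (w : C2) (hw : w ≠ 0) :
    affineCoord j (Projectivization.mk ℂ w hw) = w (1 - j) / w j := by
  obtain ⟨c, hc, h⟩ := exists_rep_mk_eq w hw
  rw [affineCoord, h, h, mul_div_mul_left _ _ hc]

theorem rep_mk_ne_zero {j : Fin 2} {w : C2} {hw : w ≠ 0}
    (h : (Projectivization.mk ℂ w hw).rep j ≠ 0) : w j ≠ 0 := by
  obtain ⟨c, -, hk⟩ := exists_rep_mk_eq w hw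
  rw [hk] at h
  exact right_ne_zero_of_mul h

/-- A map of `ℙ¹` induced by a real analytic lift to `ℂ² ∖ {0}` is real analytic. -/
theorem isRealAnalyticP1_of_lift {F : P1 → P1} (hF : Continuous F) (g : C2 → C2)
    (hg0 : ∀ v, v ≠ 0 → g v ≠ 0) (hg : ∀ v, v ≠ 0 → ∀ j, AnalyticAt ℝ (fun x => g x j) v)
    (hFg : ∀ v (hv : v ≠ 0),
      F (Projectivization.mk ℂ v hv) = Projectivization.mk ℂ (g v) (hg0 v hv)) :
    IsRealAnalyticP1 F := by
  refine ⟨hF, fun i j t ht => ?_⟩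
  have hcoord : ∀ k, AnalyticAt ℝ (fun s => g (affineVec i s) k) t := fun k =>
    AnalyticAt.comp (g := fun x => g x k) (hg _ (affineVec_ne_zero i t) k)
      (affineVec_analyticAt i t)
  rw [affinePoint, hFg] at ht
  have h : (fun s : ℂ => affineCoord j (F (affinePoint i s))) =
      fun s => g (affineVec i s) (1 - j) / g (affineVec i s) j := by
    funext s
    rw [affinePoint, hFg, affineCoord_mk]
  rw [h]
  exact (hcoord _).div (hcoord _) (rep_mk_ne_zero ht)

/-! ### The reduced space and its maps to ℙ¹ -/

theorem reducedMk_eq_iff {μ : C2 → ℝ} {b : ℝ} {x y : C2} (hx : μ x = b) (hy : μ y = b) :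
    (reducedMk x hx : ReducedSpace μ b) = reducedMk y hy ↔ ∃ c : Circle, c • y = x :=
  Quotient.eq''

theorem isQuotientMap_reducedMk {μ : C2 → ℝ} {b : ℝ} :
    IsQuotientMap (fun a : {a : C2 // μ a = b} => (reducedMk a.1 a.2 : ReducedSpace μ b)) :=
  isQuotientMap_quot_mk

theorem exists_reducedMk_eq {μ : C2 → ℝ} {b : ℝ} (x : ReducedSpace μ b) :
    ∃ a, ∃ ha : μ a = b, reducedMk a ha = x := by
  obtain ⟨⟨a, ha⟩, rfl⟩ := isQuotientMap_reducedMk.surjective x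
  exact ⟨a, ha, rfl⟩

theorem mk_circle_smul {v w : C2} (hv : v ≠ 0) (hw : w ≠ 0) (c : Circle) (h : c • w = v) :
    Projectivization.mk ℂ v hv = Projectivization.mk ℂ w hw :=
  (Projectivization.mk_eq_mk_iff' ℂ _ _ _ _).2 ⟨c, h⟩

/-- A continuous equivariant map from the level set to `ℂ² ∖ {0}` descends to the reduced
space. -/
noncomputable def reducedMap {μ : C2 → ℝ} {b : ℝ} (g : C2 → C2) (hg : Continuous g)
    (hg0 : ∀ a, μ a = b → g a ≠ 0) (hgc : ∀ (c : Circle) (a : C2), g (c • a) = c • g a) :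
    C(ReducedSpace μ b, P1) where
  toFun := Quotient.lift (fun a => Projectivization.mk ℂ (g a.1) (hg0 a.1 a.2)) (by
    rintro ⟨_, ha'⟩ ⟨a, ha⟩ ⟨c, rfl⟩
    exact mk_circle_smul _ _ c (hgc c a).symm)
  continuous_toFun := isQuotientMap_reducedMk.continuous_iff.2
    (continuous_projectivization_mk (g := fun a : {a : C2 // μ a = b} => g a.1)
      (hg.comp continuous_subtype_val) fun a => hg0 a.1 a.2)

theorem reducedMap_homotopic {μ : C2 → ℝ} {b : ℝ} (g h : C2 → C2) (hg : Continuous g)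
    (hg0 : ∀ a, μ a = b → g a ≠ 0) (hgc : ∀ (c : Circle) (a : C2), g (c • a) = c • g a)
    (hh : Continuous h)
    (hh0 : ∀ a, μ a = b → h a ≠ 0) (hhc : ∀ (c : Circle) (a : C2), h (c • a) = c • h a)
    (hgh : ∀ a, μ a = b → ∀ t : unitInterval, (1 - t : ℝ) • g a + (t : ℝ) • h a ≠ 0) :
    (reducedMap (μ := μ) g hg hg0 hgc).Homotopic (reducedMap h hh hh0 hhc) := by
  let k : unitInterval → C2 → C2 := fun t a => (1 - t : ℝ) • g a + (t : ℝ) • h a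
  have hk : ∀ t, Continuous (k t) := fun t => (hg.const_smul (1 - t : ℝ)).add (hh.const_smul (t : ℝ))
  have hkc : ∀ t (c : Circle) (a : C2), k t (c • a) = c • k t a := fun t c a => by
    simp only [k, hgc, hhc, smul_add]
    rw [smul_comm c, smul_comm c]
  refine ⟨⟨⟨fun p => reducedMap (μ := μ) (b := b) (k p.1) (hk p.1) (fun a ha => hgh a ha p.1)
    (hkc p.1) p.2, ?_⟩, fun x => ?_, fun x => ?_⟩⟩
  -- The interval is locally compact, so its product with the quotient map is again a quotient map.
  · refine isQuotientMap_reducedMk.continuous_lift_prod_right ?_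
    refine continuous_projectivization_mk
      (g := fun p : unitInterval × {a : C2 // μ a = b} => k p.1 p.2.1) ?_
      fun p => hgh p.2.1 p.2.2 p.1
    fun_prop
  · obtain ⟨a, ha, rfl⟩ := exists_reducedMk_eq x
    change Projectivization.mk ℂ (k 0 a) _ = Projectivization.mk ℂ (g a) _
    congr 1
    simp [k]
  · obtain ⟨a, ha, rfl⟩ := exists_reducedMk_eq x
    change Projectivization.mk ℂ (k 1 a) _ = Projectivization.mk ℂ (h a) _
    congr 1
    simp [k]

namespace LevelIsRadialGraph

variable {μ : C2 → ℝ} {b : ℝ} (H : LevelIsRadialGraph μ b)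

include H

/-- The phase c/‖c‖ puts both points on one ray, where the level set has a single point. -/
theorem exists_circle_smul_eq {c : ℂ} (hc : c ≠ 0) {v : C2} (hv : v ≠ 0) :
    ∃ u : Circle, u • (levelRadius μ b v • v) = levelRadius μ b (c • v) • (c • v) := by
  have hn : 0 < ‖c‖ := norm_pos_iff.2 hc
  have hn' : (‖c‖ : ℂ) ≠ 0 := by exact_mod_cast hn.ne'
  let u : Circle := ⟨c / ‖c‖, mem_sphere_zero_iff_norm.2 (by simp [hc])⟩
  have h1 : u • (levelRadius μ b v • v) = (levelRadius μ b v / ‖c‖) • (c • v) := by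
    rw [Circle.smul_def, ← Complex.coe_smul, ← Complex.coe_smul, smul_smul, smul_smul]
    congr 1
    simp only [u]
    push_cast
    ring
  have h2 := H.eq_radius (c • v) (smul_ne_zero hc hv) (levelRadius μ b v / ‖c‖)
    (div_pos (H.radius_pos v hv) hn) (by rw [← h1, H.smul_circle, H.radius_mem v hv])
  exact ⟨u, by rw [h1, h2]⟩

theorem levelRadius_eq_one {a : C2} (ha : μ a = b) : levelRadius μ b a = 1 :=
  (H.eq_radius a (H.ne_zero a ha) 1 one_pos (by rwa [one_smul])).symm

/-- The identification of the reduced space with `ℙ¹`. -/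
noncomputable def homeomorphP1 : ReducedSpace μ b ≃ₜ P1 where
  toFun := reducedMap id continuous_id H.ne_zero fun _ _ => rfl
  invFun := Projectivization.lift
    (fun v => reducedMk (levelRadius μ b v.1 • v.1) (H.radius_mem v.1 v.2)) (by
      rintro ⟨_, hv⟩ ⟨w, hw⟩ c rfl
      have hc : c ≠ 0 := left_ne_zero_of_smul hv
      exact (reducedMk_eq_iff _ _).2 (H.exists_circle_smul_eq hc hw))
  left_inv x := by
    obtain ⟨a, ha, rfl⟩ := exists_reducedMk_eq x
    refine (reducedMk_eq_iff (H.radius_mem a (H.ne_zero a ha)) ha).2 ⟨1, ?_⟩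
    rw [H.levelRadius_eq_one ha, one_smul, one_smul]
  right_inv p := by
    induction p using Projectivization.ind with
    | h v hv =>
      refine (Projectivization.mk_eq_mk_iff' ℂ _ _ _ _).2 ⟨levelRadius μ b v, ?_⟩
      exact Complex.coe_smul _ _
  continuous_toFun :=
    (reducedMap (μ := μ) (b := b) id continuous_id H.ne_zero fun _ _ => rfl).continuous
  continuous_invFun := by
    have h1 : Continuous fun v : {v : C2 // v ≠ 0} => levelRadius μ b v.1 • v.1 :=
      Continuous.smul (continuous_iff_continuousAt.2 fun v =>
        (H.analyticAt_radius v.1 v.2).continuousAt.comp continuous_subtype_val.continuousAt)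
        continuous_subtype_val
    exact isQuotientMap_mk'.continuous_iff.2
      (isQuotientMap_reducedMk.continuous.comp (h1.subtype_mk fun v => H.radius_mem v.1 v.2))

end LevelIsRadialGraph

/-! ### Degree and conclusion -/

theorem hasDegree_one_of_homotopic_id {F : C(P1, P1)}
    (hF : F.Homotopic (ContinuousMap.id P1)) : HasDegree F 1 := by
  obtain ⟨K⟩ := hF
  intro x
  have h1 : mapH2P1 F = mapH2P1 (ContinuousMap.id P1) :=
    TopCat.Homotopy.congr_homologyMap_singularChainComplexFunctor
      (f := TopCat.ofHom F) (g := TopCat.ofHom (ContinuousMap.id P1)) K (ModuleCat.of ℤ ℤ) 2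
  have h2 : mapH2P1 (ContinuousMap.id P1) = CategoryTheory.CategoryStruct.id H2P1 :=
    CategoryTheory.Functor.map_id _ _
  rw [h1, h2, one_smul]
  rfl

theorem corollary2p4 (φ : C2 → ℝ) (hφ : AnalyticOnNhd ℝ φ Set.univ)
    (hinv : ∀ (c : Circle) (a : C2), φ (c • a) = φ a)
    (ε : ℝ) (hε : 0 < ε) (hpsh : DdcGe φ ε)
    (μ : C2 → ℝ) (hμ : IsMomentMap φ μ)
    (b : ℝ) (hb : b ∈ Set.range μ) (hreg : IsRegularValue μ b) :
    ∃ (h0 : ∀ a : C2, μ a = b → a ≠ 0)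
      (hgrad : ∀ a : C2, μ a = b → dbar φ a ≠ 0)
      (ι : ReducedSpace μ b ≃ₜ P1)
      (f : C(ReducedSpace μ b, P1)),
      (∀ (a : C2) (ha : μ a = b), ι (reducedMk a ha) = Projectivization.mk ℂ a (h0 a ha)) ∧
      (∀ (a : C2) (ha : μ a = b),
        f (reducedMk a ha) = Projectivization.mk ℂ (dbar φ a) (hgrad a ha)) ∧
      IsRealAnalyticP1 (fun p => f (ι.symm p)) ∧
      HasDegree (f.comp (ι.symm : C(P1, ReducedSpace μ b))) 1 := by
  have H := hμ.levelIsRadialGraph hφ hinv hε hpsh hb hreg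
  have hpos : ∀ a, μ a = b → 0 < (inner ℂ (dbar φ a) a).re := by
    intro a ha
    have h1 := hμ.eq_radial hφ hinv a
    have h2 := hμ.zero_lt_of_regular hφ hε hpsh hb hreg
    rw [re_inner_dbar]
    linarith
  have hgrad : ∀ a, μ a = b → dbar φ a ≠ 0 := by
    intro a ha h
    have := hpos a ha
    simp [h] at this
  let f : C(ReducedSpace μ b, P1) :=
    reducedMap (dbar φ) (dbar_continuous hφ) hgrad (dbar_circle_smul hφ hinv)
  refine ⟨H.ne_zero, hgrad, H.homeomorphP1, f, fun a ha => rfl, fun a ha => rfl, ?_, ?_⟩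
  · refine isRealAnalyticP1_of_lift (f.continuous.comp H.homeomorphP1.symm.continuous)
      (fun v => dbar φ (levelRadius μ b v • v)) (fun v hv => hgrad _ (H.radius_mem v hv))
      (fun v hv j => ?_) fun v hv => rfl
    exact AnalyticAt.comp (g := fun x => dbar φ x j) (dbar_analyticAt hφ _ j)
      ((H.analyticAt_radius v hv).smul analyticAt_id)
  · refine hasDegree_one_of_homotopic_id ?_
    have h1 : f.Homotopic (reducedMap id continuous_id H.ne_zero fun _ _ => rfl) := by
      refine reducedMap_homotopic _ _ _ _ _ _ _ _ fun a ha t h => ?_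
      -- Pairing with a gives (1 - t) Re⟨∂̄φ(a), a⟩ + t‖a‖² = 0, impossible for t in [0, 1].
      have h2 := congrArg (fun w : C2 => (inner ℂ w a).re) h
      have h3 : 0 < (inner ℂ a a).re := by
        have : 0 < ‖a‖ := norm_pos_iff.2 (H.ne_zero a ha)
        have h4 : (inner ℂ a a).re = ‖a‖ ^ 2 := inner_self_eq_norm_sq (𝕜 := ℂ) a
        rw [h4]
        positivity
      have h5 := hpos a ha
      simp only [← Complex.coe_smul, id, inner_add_left, inner_smul_left, Complex.conj_ofReal,
        Complex.add_re, Complex.re_ofReal_mul, inner_zero_left, Complex.zero_re] at h2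
      rcases t.2.1.eq_or_lt with ht | ht
      · rw [← ht] at h2
        simp at h2
        exact h5.ne' h2
      · have := mul_pos ht h3
        have := mul_nonneg (sub_nonneg.2 t.2.2) h5.le
        linarith
    have h2 := h1.comp (ContinuousMap.Homotopic.refl
      (H.homeomorphP1.symm : C(P1, ReducedSpace μ b)))
    convert h2
    ext p
    exact (H.homeomorphP1.apply_symm_apply p).symm
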